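/- For a metric space $(M,\delta)$ and $s\in\mathbb N$, $s\ge 1$, let $\mathsf{EMD}_s(M)$ be the metric space of multisets of $s$ points of $M$, with the Earth Mover's distance \[ \mathsf{EMD}(\{a_1,\dots,a_s\},\{b_1,\dots,b_s\})=\min_{\pi}\sum_{i=1}^s \delta(a_i,b_{\pi(i)}), \] the minimum being over all bijections $\pi:\{1,\dots,s\}\to\{1,\dots,s\}$. The hypercube $\{0,1\}^d$ carries the Hamming ($\ell_1$) metric. For a metric space $(X,d_X)$, a probability distribution $\mu$ on $X$, a threshold $r>0$ and $c>1$, a probability distribution $\mathcal D$ over maps $h:X\to U$ into some set $U$ (with the collision events below measurable) is called $(r,cr,p_1,p_2)$-sensitive for $\mu$ if (1) $\Pr_{h\sim\mathcal D}[h(x)=h(y)]\ge p_1$ for all $x,y\in X$ with $d_X(x,y)\le r$, and (2) $\Pr_{h\sim\mathcal D,\;y\sim\mu}[\,d_X(x,y)>cr \text{ and } h(x)=h(y)\,]\le p_2$ for every $x\in X$, where $h$ and $y$ are drawn independently. We say that $X$ has an $(r,cr,p_1,p_2)$-sensitive data-dependent LSH if for every probability distribution $\mu$ on $X$ there are a set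 $U$ and a distribution $\mathcal D$ over maps $X\to U$ (both may depend on $\mu$) that is $(r,cr,p_1,p_2)$-sensitive for $\mu$. **Theorem.** Let $0<p_2<p_1<1$ be constants. There is a constant $C>0$, depending only on $p_1$ and $p_2$, such that for every integer $s\ge 1$ and every real $c>1$: if for all integers $d\ge 1$ and all reals $r>0$ the space $\mathsf{EMD}_s(\{0,1\}^d)$ has an $(r,cr,p_1,p_2)$-sensitive data-dependent LSH, then $c\ge C\log s$. (That is, the approximation factor $c=c(s)$ of such a family of hashes satisfies $c=\Omega(\log s)$.) -/

import Mathlib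

open MeasureTheory

universe u v

/-! ### The Earth Mover's Distance -/

/-- The minimum cost of a perfect matching between two `s`-tuples of points:
`min_π ∑ i, d(a i, b (π i))` over all bijections `π : [s] → [s]`
(an infimum over a finite nonempty set, hence a minimum). -/
noncomputable def matchingCost {α : Type u} [Dist α] {s : ℕ} (a b : Fin s → α) : ℝ :=
  ⨅ π : Equiv.Perm (Fin s), ∑ i, dist (a i) (b (π i))

/-- The underlying set of `EMD_s(α)`: multisets of `s` points of `α`. -/
def EMD (α : Type u) (s : ℕ) : Type u := Sym α s

namespace EMD

variable {α : Type u} {s : ℕ}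

/-- The multiset `{a_1, …, a_s}` of the entries of a tuple. -/
def ofTuple (a : Fin s → α) : EMD α s :=
  ⟨Finset.univ.val.map a, by simp⟩

theorem exists_ofTuple (x : EMD α s) : ∃ a : Fin s → α, ofTuple a = x := by
  obtain ⟨m, hm⟩ := x
  induction m using Quotient.inductionOn with
  | _ l =>
    have hl : l.length = s := by simpa using hm
    subst hl
    refine ⟨l.get, Subtype.ext ?_⟩
    change Multiset.map l.get (Finset.univ : Finset (Fin l.length)).val = (l : Multiset α)
    rw [Fin.univ_val_map, List.ofFn_get]

theorem ofTuple_eq_iff (a b : Fin s → α) :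
    ofTuple a = ofTuple b ↔ ∃ π : Equiv.Perm (Fin s), a = b ∘ π := by
  classical
  constructor
  · intro h
    have h1 : Finset.univ.val.map a = Finset.univ.val.map b := congrArg Subtype.val h
    have h2 : ∀ c, Nonempty ({i // a i = c} ≃ {i // b i = c}) := by
      intro c
      have h3 := congrArg (Multiset.count c) h1
      rw [Multiset.count_map, Multiset.count_map] at h3
      refine ⟨Fintype.equivOfCardEq ?_⟩
      rw [Fintype.card_subtype, Fintype.card_subtype]
      simpa [Finset.card_def, eq_comm] using h3
    have e := fun c => Classical.choice (h2 c)
    refine ⟨Equiv.ofFiberEquiv e, ?_⟩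
    funext i
    exact (Equiv.ofFiberEquiv_map e i).symm
  · rintro ⟨π, rfl⟩
    refine Subtype.ext ?_
    change Multiset.map (b ∘ π) Finset.univ.val = Multiset.map b Finset.univ.val
    rw [← Multiset.map_map, Multiset.map_univ_val_equiv]

/-- An (arbitrary) enumeration `x = {x_1, …, x_s}` of a multiset of `s` points. -/
noncomputable def enum (x : EMD α s) : Fin s → α := (exists_ofTuple x).choose

theorem ofTuple_enum (x : EMD α s) : ofTuple x.enum = x := (exists_ofTuple x).choose_spec

theorem matchingCost_le [Dist α] (a b : Fin s → α) (π : Equiv.Perm (Fin s)) :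
    matchingCost a b ≤ ∑ i, dist (a i) (b (π i)) :=
  ciInf_le (Set.finite_range _).bddBelow π

theorem exists_matchingCost_eq [Dist α] (a b : Fin s → α) :
    ∃ π : Equiv.Perm (Fin s), ∑ i, dist (a i) (b (π i)) = matchingCost a b :=
  exists_eq_ciInf_of_finite

theorem matchingCost_comp [Dist α] (a b : Fin s → α) (σ τ : Equiv.Perm (Fin s)) :
    matchingCost (a ∘ σ) (b ∘ τ) = matchingCost a b := by
  unfold matchingCost
  refine ((Equiv.mulRight σ).trans (Equiv.mulLeft τ⁻¹)).iInf_congr (fun π => ?_) |>.symm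
  rw [← Equiv.sum_comp σ (fun i => dist (a i) (b (π i)))]
  simp

/-- The Earth Mover's Distance between two multisets of size `s`. -/
noncomputable instance [Dist α] : Dist (EMD α s) :=
  ⟨fun x y => matchingCost x.enum y.enum⟩

/-- The distance does not depend on how the multisets are enumerated. -/
theorem dist_ofTuple [Dist α] (a b : Fin s → α) :
    dist (ofTuple a) (ofTuple b) = matchingCost a b := by
  obtain ⟨σ, hσ⟩ := (ofTuple_eq_iff _ _).1 (ofTuple_enum (ofTuple a))
  obtain ⟨τ, hτ⟩ := (ofTuple_eq_iff _ _).1 (ofTuple_enum (ofTuple b))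
  change matchingCost (ofTuple a).enum (ofTuple b).enum = _
  rw [hσ, hτ, matchingCost_comp]

noncomputable instance [MetricSpace α] : MetricSpace (EMD α s) where
  dist_self x := by
    obtain ⟨a, rfl⟩ := exists_ofTuple x
    rw [dist_ofTuple]
    refine le_antisymm ?_ (le_ciInf fun π => Finset.sum_nonneg fun i _ => dist_nonneg)
    simpa using matchingCost_le a a 1
  dist_comm x y := by
    have key : ∀ a b : Fin s → α, matchingCost a b ≤ matchingCost b a := by
      intro a b
      obtain ⟨π, hπ⟩ := exists_matchingCost_eq b a
      refine (matchingCost_le a b π⁻¹).trans_eq ?_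
      rw [← hπ, ← Equiv.sum_comp π]
      simp [dist_comm]
    exact le_antisymm (key _ _) (key _ _)
  dist_triangle x y z := by
    obtain ⟨σ, hσ⟩ := exists_matchingCost_eq x.enum y.enum
    obtain ⟨τ, hτ⟩ := exists_matchingCost_eq y.enum z.enum
    change matchingCost _ _ ≤ matchingCost _ _ + matchingCost _ _
    refine (matchingCost_le x.enum z.enum (τ * σ)).trans ?_
    rw [← hσ, ← hτ, ← Equiv.sum_comp σ (fun i => dist (y.enum i) (z.enum (τ i))),
      ← Finset.sum_add_distrib]
    exact Finset.sum_le_sum fun i _ => dist_triangle _ _ _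
  eq_of_dist_eq_zero {x y} h := by
    obtain ⟨σ, hσ⟩ := exists_matchingCost_eq x.enum y.enum
    change matchingCost _ _ = 0 at h
    rw [h, Finset.sum_eq_zero_iff_of_nonneg fun i _ => dist_nonneg] at hσ
    rw [← ofTuple_enum x, ← ofTuple_enum y, ofTuple_eq_iff]
    exact ⟨σ, funext fun i => dist_eq_zero.1 (hσ i (Finset.mem_univ i))⟩

noncomputable instance [MetricSpace α] : MeasurableSpace (EMD α s) := borel _

instance [MetricSpace α] : BorelSpace (EMD α s) := ⟨rfl⟩

end EMD

/-- The hypercube `{0,1}^d` with the Hamming (that is, `ℓ₁`) metric. -/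
abbrev Hypercube (d : ℕ) : Type := Hamming fun _ : Fin d => Bool

/-! ### Data-dependent locality-sensitive hashing -/

/-- A probability distribution `D` over maps `h : X → U` is `(r, R, p₁, p₂)`-sensitive for the
distribution `μ` on the metric space `X`. The σ-algebra on the set of maps is arbitrary, subject to
the two events in question being measurable. -/
structure IsSensitiveFor {X : Type u} {U : Type v} [MetricSpace X] [MeasurableSpace X]
    [MeasurableSpace (X → U)] (D : Measure (X → U)) (μ : Measure X) (r R p₁ p₂ : ℝ) : Prop where
  measurableSet_collide : ∀ x y : X, MeasurableSet {h : X → U | h x = h y}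
  measurableSet_far_collide : ∀ x : X,
    MeasurableSet {q : (X → U) × X | R < dist x q.2 ∧ q.1 x = q.1 q.2}
  close_collide : ∀ x y : X, dist x y ≤ r → p₁ ≤ D.real {h | h x = h y}
  far_separate : ∀ x : X, (D.prod μ).real {q | R < dist x q.2 ∧ q.1 x = q.1 q.2} ≤ p₂

/-- The metric space `X` admits an `(r, R, p₁, p₂)`-sensitive data-dependent LSH: for every
probability distribution `μ` on `X` there are a set `U` of hash values and a probability
distribution over maps `X → U`, both of which may depend on `μ`, that is sensitive for `μ`. -/
def HasDataDependentLSH (X : Type u) [MetricSpace X] [MeasurableSpace X] (r R p₁ p₂ : ℝ) : Prop :=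
  ∀ μ : Measure X, IsProbabilityMeasure μ →
    ∃ (U : Type v) (_ : MeasurableSpace (X → U)) (D : Measure (X → U)),
      IsProbabilityMeasure D ∧ IsSensitiveFor D μ r R p₁ p₂

open Matrix

/-! The obstruction is a hard family of point sets: the cosets of a linear code. Take a parity-check
matrix `G` whose kernel has relative distance above `1/16` (`exists_parityCheck`), and send `x` to
the coset of `x` by the row space of `G`, viewed as a multiset of `2 ^ k` points padded by a far
point.

A hash of this multiset is a function of `x` invariant under the row space, so the Walsh spectra of
its level sets live on the kernel of `G`, where every nonzero frequency is heavy. Each step of a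
lazy walk therefore shrinks the nonconstant part by `15/16`: after `K` steps, the endpoints collide
at most `(15/16) ^ K` more often than independent points (`sum_walk_collision_real_le`).

A `K`-step walk moves the multiset by at most `2 ^ k * K`, which forces collisions with probability
`p₁`. Independent cosets are at distance at least `2 ^ k * (m + 1)` outside a fraction `(43/256) ^
m` of pairs, by counting Hamming balls. If `c * K < m + 1`, these facts bound `p₁ - p₂` by two small
terms (`sensitive_gap_le`). A fixed large `K` thus forces `c ≥ (m + 1) / K` for large `m`, with `m`
of order `log s`. -/

/-! ### Fourier analysis on `𝔽₂ⁿ` -/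

/-- The nontrivial sign character of `𝔽₂`. -/
def signChar (a : ZMod 2) : ℝ := if a = 0 then 1 else -1

theorem signChar_zero : signChar 0 = 1 := if_pos rfl

theorem signChar_of_ne_zero {a : ZMod 2} (ha : a ≠ 0) : signChar a = -1 := if_neg ha

theorem zmod_two_eq_one_of_ne_zero {a : ZMod 2} (ha : a ≠ 0) : a = 1 := by
  revert a; decide

theorem signChar_add (a b : ZMod 2) : signChar (a + b) = signChar a * signChar b := by
  by_cases ha : a = 0
  · simp [ha, signChar_zero]
  by_cases hb : b = 0
  · simp [hb, signChar_zero]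
  rw [signChar_of_ne_zero ha, signChar_of_ne_zero hb, zmod_two_eq_one_of_ne_zero ha,
    zmod_two_eq_one_of_ne_zero hb, show (1 + 1 : ZMod 2) = 0 by decide, signChar_zero]
  norm_num

theorem signChar_sum {ι : Type*} (s : Finset ι) (f : ι → ZMod 2) :
    signChar (∑ i ∈ s, f i) = ∏ i ∈ s, signChar (f i) := by
  classical
  induction s using Finset.induction_on with
  | empty => simp [signChar_zero]
  | insert a s ha ih => rw [Finset.sum_insert ha, Finset.prod_insert ha, signChar_add, ih]

theorem sum_signChar_mul (a : ZMod 2) :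
    ∑ b : ZMod 2, signChar (a * b) = if a = 0 then 2 else 0 := by
  have hu : (Finset.univ : Finset (ZMod 2)) = {0, 1} := by decide
  rw [hu, Finset.sum_pair (by decide)]
  by_cases ha : a = 0
  · simp [ha, signChar_zero]; norm_num
  · simp [ha, signChar_zero, signChar_of_ne_zero]

/-- The Walsh characters of the group `𝔽₂ⁿ`. -/
def walsh {n : ℕ} (S x : Fin n → ZMod 2) : ℝ := signChar (S ⬝ᵥ x)

theorem walsh_add {n : ℕ} (S x y : Fin n → ZMod 2) :
    walsh S (x + y) = walsh S x * walsh S y := by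
  rw [walsh, dotProduct_add, signChar_add]; rfl

theorem walsh_sum {n : ℕ} {ι : Type*} (s : Finset ι) (S : Fin n → ZMod 2)
    (x : ι → Fin n → ZMod 2) : walsh S (∑ i ∈ s, x i) = ∏ i ∈ s, walsh S (x i) := by
  rw [walsh, dotProduct_sum, signChar_sum]; rfl

theorem walsh_zero_left {n : ℕ} (x : Fin n → ZMod 2) : walsh 0 x = 1 := by
  simp [walsh, signChar_zero]

theorem walsh_zero_right {n : ℕ} (S : Fin n → ZMod 2) : walsh S 0 = 1 := by
  simp [walsh, signChar_zero]

theorem add_self_zmod_two {n : ℕ} (x : Fin n → ZMod 2) : x + x = 0 := by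
  funext i
  exact CharTwo.add_self_eq_zero (x i)

theorem sum_walsh {n : ℕ} (x : Fin n → ZMod 2) :
    ∑ S, walsh S x = if x = 0 then (2 : ℝ) ^ n else 0 := by
  have h : ∀ S : Fin n → ZMod 2, walsh S x = ∏ i, signChar (x i * S i) := fun S => by
    rw [walsh, dotProduct, signChar_sum]
    simp_rw [mul_comm]
  simp_rw [h]
  rw [← Fintype.piFinset_univ, ← Finset.prod_univ_sum (fun _ => Finset.univ)
    (fun i b => signChar (x i * b))]
  simp_rw [sum_signChar_mul]
  by_cases hx : x = 0
  · simp [hx]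
  · obtain ⟨i, hi⟩ := Function.ne_iff.1 hx
    rw [if_neg hx]
    exact Finset.prod_eq_zero (Finset.mem_univ i) (if_neg hi)

/-- The (unnormalised) Walsh transform. -/
noncomputable def walshTransform {n : ℕ} (f : (Fin n → ZMod 2) → ℝ) (S : Fin n → ZMod 2) : ℝ :=
  ∑ x, f x * walsh S x

/-- Autocorrelation form of Parseval's identity, which is the case `e = 0`: summing over characters
leaves only the pairs with `y = x + e`. -/
theorem sum_walshTransform_sq_mul {n : ℕ} (f : (Fin n → ZMod 2) → ℝ) (e : Fin n → ZMod 2) :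
    ∑ S, walshTransform f S ^ 2 * walsh S e = 2 ^ n * ∑ x, f x * f (x + e) := by
  have h : ∀ S, walshTransform f S ^ 2 * walsh S e
      = ∑ x, ∑ y, f x * f y * walsh S (x + e + y) := fun S => by
    rw [walshTransform, sq, Finset.sum_mul_sum, Finset.sum_mul]
    refine Finset.sum_congr rfl fun x _ => ?_
    rw [Finset.sum_mul]
    refine Finset.sum_congr rfl fun y _ => ?_
    rw [walsh_add, walsh_add]; ring
  simp_rw [h]
  rw [Finset.sum_comm, Finset.mul_sum]
  refine Finset.sum_congr rfl fun x _ => ?_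
  rw [Finset.sum_comm]
  simp_rw [← Finset.mul_sum, sum_walsh]
  rw [Finset.sum_eq_single (x + e)]
  · rw [if_pos (add_self_zmod_two _)]; ring
  · intro y _ hy
    rw [if_neg, mul_zero]
    intro h0
    apply hy
    have : (x + e) + (x + e + y) = x + e := by rw [h0, add_zero]
    rwa [← add_assoc, add_self_zmod_two, zero_add] at this
  · simp

/-- If `(G *ᵥ S) i ≠ 0`, translation by the `i`-th row of `G` fixes `f` but negates the character,
so the transform equals its own negative. -/
theorem walshTransform_eq_zero {n k : ℕ} (G : Matrix (Fin k) (Fin n) (ZMod 2))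
    (f : (Fin n → ZMod 2) → ℝ) (hf : ∀ x u, f (x + u ᵥ* G) = f x) {S : Fin n → ZMod 2}
    (hS : G *ᵥ S ≠ 0) : walshTransform f S = 0 := by
  obtain ⟨i, hi⟩ := Function.ne_iff.1 hS
  have hw : walsh S (Pi.single i 1 ᵥ* G) = -1 := by
    rw [walsh, dotProduct_comm, ← dotProduct_mulVec, single_dotProduct, one_mul]
    exact signChar_of_ne_zero hi
  have h : walshTransform f S = -walshTransform f S := by
    conv_lhs => rw [walshTransform, ← Equiv.sum_comp (Equiv.addRight (Pi.single i 1 ᵥ* G))]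
    simp_rw [Equiv.coe_addRight, hf, walsh_add, hw]
    simp [walshTransform]
  linarith

/-! ### Lazy walks and collisions of invariant functions -/

/-- The displacement of a lazy walk whose `j`-th step changes the coordinate `(w j).1` by
`(w j).2`. -/
def walkSum {n K : ℕ} (w : Fin K → Fin n × ZMod 2) : Fin n → ZMod 2 :=
  ∑ j, Pi.single (w j).1 (w j).2

/-- Steps are independent, so the sum factors; in one step a coordinate outside the support of `S`
contributes `2`, and one inside cancels. -/
theorem sum_walsh_walkSum {n : ℕ} (K : ℕ) (S : Fin n → ZMod 2) :
    ∑ w : Fin K → Fin n × ZMod 2, walsh S (walkSum w) = (2 * ((n : ℝ) - hammingNorm S)) ^ K := by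
  have h1 : ∑ p : Fin n × ZMod 2, walsh S (Pi.single p.1 p.2) = 2 * ((n : ℝ) - hammingNorm S) := by
    rw [Fintype.sum_prod_type]
    simp_rw [walsh, dotProduct_single, sum_signChar_mul]
    have h2 := Finset.card_filter_add_card_filter_not (s := (Finset.univ : Finset (Fin n)))
      (fun i => S i = 0)
    rw [Finset.card_univ, Fintype.card_fin] at h2
    rw [← Finset.sum_filter, Finset.sum_const, hammingNorm, nsmul_eq_mul]
    have h3 := congrArg (Nat.cast (R := ℝ)) h2
    push_cast at h3
    change _ = 2 * ((n : ℝ) - ((Finset.univ.filter fun i => ¬S i = 0).card : ℝ))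
    linarith
  simp_rw [walkSum, walsh_sum]
  rw [← h1, ← Fintype.piFinset_univ, ← Finset.prod_univ_sum (fun _ => Finset.univ)
    (fun (_ : Fin K) (p : Fin n × ZMod 2) => walsh S (Pi.single p.1 p.2))]
  simp

/-- Spectral gap: the zero frequency gives the squared mean, frequencies outside the kernel of `G`
vanish, and the remaining ones are damped by `ρ ^ K` and summed by Parseval. -/
theorem sum_walk_correlation_le {n k K : ℕ} (G : Matrix (Fin k) (Fin n) (ZMod 2))
    (f : (Fin n → ZMod 2) → ℝ) (hf : ∀ x u, f (x + u ᵥ* G) = f x) {ρ : ℝ} (hρ0 : 0 ≤ ρ)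
    (hρ : ∀ S, G *ᵥ S = 0 → S ≠ 0 → (n : ℝ) - hammingNorm S ≤ ρ * n) :
    2 ^ n * ∑ w : Fin K → Fin n × ZMod 2, ∑ x, f x * f (x + walkSum w)
      ≤ (2 * n) ^ K * ((∑ x, f x) ^ 2 + ρ ^ K * (2 ^ n * ∑ x, f x ^ 2)) := by
  have hP := sum_walshTransform_sq_mul f 0
  simp_rw [walsh_zero_right, mul_one, add_zero, ← sq] at hP
  rw [Finset.mul_sum]
  simp_rw [← sum_walshTransform_sq_mul]
  rw [Finset.sum_comm]
  simp_rw [← Finset.mul_sum, sum_walsh_walkSum]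
  rw [← hP, mul_add, ← mul_assoc, ← Finset.add_sum_erase _ _ (Finset.mem_univ 0)]
  refine add_le_add ?_ ?_
  · simp [walshTransform, walsh_zero_left, mul_comm]
  · calc _ ≤ ∑ S ∈ Finset.univ.erase 0, (2 * (n : ℝ)) ^ K * ρ ^ K * walshTransform f S ^ 2 := by
          refine Finset.sum_le_sum fun S hS => ?_
          by_cases h : G *ᵥ S = 0
          · rw [mul_comm]
            refine mul_le_mul_of_nonneg_right ?_ (sq_nonneg _)
            rw [← mul_pow]
            have h1 := hρ S h (Finset.ne_of_mem_erase hS)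
            have h2 : (hammingNorm S : ℝ) ≤ n := by
              exact_mod_cast hammingNorm_le_card_fintype.trans_eq (Fintype.card_fin n)
            exact pow_le_pow_left₀ (by linarith) (by linarith) K
          · simp [walshTransform_eq_zero G f hf h]
      _ ≤ ∑ S, (2 * (n : ℝ)) ^ K * ρ ^ K * walshTransform f S ^ 2 := by
          refine Finset.sum_le_sum_of_subset_of_nonneg (Finset.erase_subset _ _) fun S _ _ => ?_
          positivity
      _ = _ := by rw [Finset.mul_sum]

-- A collision is a sum over hash values of products of level-set indicators; apply the correlation
-- bound to each indicator. The level sets partition the cube, so their squared norms add up to `2 ^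
-- n`.
open Classical in
theorem sum_walk_collision_le {n k K : ℕ} (G : Matrix (Fin k) (Fin n) (ZMod 2)) {U : Type v}
    (g : (Fin n → ZMod 2) → U) (hg : ∀ x u, g (x + u ᵥ* G) = g x) {ρ : ℝ} (hρ0 : 0 ≤ ρ)
    (hρ : ∀ S, G *ᵥ S = 0 → S ≠ 0 → (n : ℝ) - hammingNorm S ≤ ρ * n) :
    2 ^ n * ∑ w : Fin K → Fin n × ZMod 2, ∑ x, (if g x = g (x + walkSum w) then (1 : ℝ) else 0)
      ≤ (2 * n) ^ K * (∑ x, ∑ y, (if g x = g y then (1 : ℝ) else 0) + ρ ^ K * 4 ^ n) := by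
  have key : ∀ x y, (if g x = g y then (1 : ℝ) else 0)
      = ∑ a ∈ Finset.univ.image g, (if g x = a then 1 else 0) * (if g y = a then 1 else 0) := by
    intro x y
    rw [Finset.sum_eq_single (g x)]
    · simp [eq_comm]
    · intro b _ hb; rw [if_neg (Ne.symm hb), zero_mul]
    · intro h; exact absurd (Finset.mem_image_of_mem g (Finset.mem_univ x)) h
  have hsq : ∑ a ∈ Finset.univ.image g, ∑ x, (if g x = a then (1 : ℝ) else 0) ^ 2 = 2 ^ n := by
    simp_rw [sq]
    rw [Finset.sum_comm]
    rw [Finset.sum_congr rfl fun x _ => (key x x).symm]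
    simp [ZMod.card]
  have h1 : ∀ a ∈ Finset.univ.image g, _ := fun a _ => sum_walk_correlation_le (K := K) G
    (fun x => if g x = a then (1 : ℝ) else 0) (fun x u => by rw [hg]) hρ0 hρ
  have h2 := Finset.sum_le_sum h1
  rw [← Finset.mul_sum, ← Finset.mul_sum, Finset.sum_add_distrib, ← Finset.mul_sum,
    ← Finset.mul_sum, hsq, ← mul_pow] at h2
  have hW : ∑ w : Fin K → Fin n × ZMod 2, ∑ x, (if g x = g (x + walkSum w) then (1 : ℝ) else 0)
      = ∑ a ∈ Finset.univ.image g, ∑ w : Fin K → Fin n × ZMod 2, ∑ x,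
        (if g x = a then 1 else 0) * (if g (x + walkSum w) = a then 1 else 0) := by
    symm
    rw [Finset.sum_comm]
    refine Finset.sum_congr rfl fun w _ => ?_
    rw [Finset.sum_comm]
    exact Finset.sum_congr rfl fun x _ => (key _ _).symm
  have hXY : ∑ x, ∑ y, (if g x = g y then (1 : ℝ) else 0)
      = ∑ a ∈ Finset.univ.image g, (∑ x, if g x = a then (1 : ℝ) else 0) ^ 2 := by
    symm
    simp_rw [sq, Finset.sum_mul_sum]
    rw [Finset.sum_comm]
    refine Finset.sum_congr rfl fun x _ => ?_
    rw [Finset.sum_comm]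
    exact Finset.sum_congr rfl fun y _ => (key _ _).symm
  rw [hW, hXY]
  have h4 : (2 : ℝ) * 2 = 4 := by norm_num
  rwa [h4] at h2

theorem hammingNorm_walkSum_le {n K : ℕ} (w : Fin K → Fin n × ZMod 2) :
    hammingNorm (walkSum w) ≤ K := by
  refine (Finset.card_le_card (t := Finset.univ.image fun j => (w j).1) fun i hi => ?_).trans
    (Finset.card_image_le.trans_eq (by simp))
  by_contra hcon
  refine (Finset.mem_filter.1 hi).2 ?_
  rw [walkSum, Finset.sum_apply]
  refine Finset.sum_eq_zero fun j _ => Pi.single_eq_of_ne (fun h => hcon ?_) _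
  exact Finset.mem_image.2 ⟨j, Finset.mem_univ j, h.symm⟩

/-! ### A good linear code by counting -/

theorem card_mulVec_eq_zero_mul_le {n k : ℕ} {y : Fin n → ZMod 2} (hy : y ≠ 0) :
    (Finset.univ.filter fun G : Matrix (Fin k) (Fin n) (ZMod 2) => G *ᵥ y = 0).card * 2 ^ k
      ≤ Fintype.card (Matrix (Fin k) (Fin n) (ZMod 2)) := by
  obtain ⟨i, hi⟩ := Function.ne_iff.1 hy
  have hi1 : y i = 1 := by
    have : ∀ a : ZMod 2, a ≠ 0 → a = 1 := by decide
    exact this _ hi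
  have hk : (Finset.univ : Finset (Fin k → ZMod 2)).card = 2 ^ k := by simp [ZMod.card]
  rw [← hk, ← Finset.card_product, ← Finset.card_univ]
  -- Adding `a` to column `i`, where `y i = 1`, changes the image of `y` from `0` to `a`, so the sum
  -- determines both `a` and `G`.
  refine Finset.card_le_card_of_injOn
    (fun p => p.1 + vecMulVec p.2 (Pi.single i 1)) (fun _ _ => Finset.mem_coe.2 (Finset.mem_univ _)) ?_
  rintro ⟨G, a⟩ hG ⟨H, b⟩ hH h
  simp only [Finset.coe_product, Set.mem_prod, Finset.mem_coe, Finset.mem_filter,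
    Finset.mem_univ, true_and, and_true] at hG hH
  have h1 := congrArg (fun M => M *ᵥ y) h
  simp only [add_mulVec, hG, hH, zero_add, vecMulVec_mulVec, single_dotProduct, hi1] at h1
  have hab : a = b := by simpa using h1
  subst hab
  exact Prod.ext (add_right_cancel h) rfl

/-- Exponential Markov bound: each `y` in the ball contributes at least `16⁻ᵐ` to the sum of `(1/16)
^ hammingNorm y`, which factors over coordinates. -/
theorem card_hammingNorm_le_mul_pow {n : ℕ} (m : ℕ) :
    ((Finset.univ.filter fun y : Fin n → ZMod 2 => hammingNorm y ≤ m).card : ℝ)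
      ≤ (17 / 16) ^ n * 16 ^ m := by
  have hsum : ∑ y : Fin n → ZMod 2, (1 / 16 : ℝ) ^ hammingNorm y = (17 / 16) ^ n := by
    have h : ∀ y : Fin n → ZMod 2, (1 / 16 : ℝ) ^ hammingNorm y
        = ∏ i, (if y i ≠ 0 then (1 / 16 : ℝ) else 1) := fun y => by
      rw [Finset.prod_ite, Finset.prod_const, Finset.prod_const_one, mul_one, hammingNorm]
    simp_rw [h]
    rw [← Fintype.piFinset_univ, ← Finset.prod_univ_sum (fun _ => Finset.univ)
      (fun _ (b : ZMod 2) => if b ≠ 0 then (1 / 16 : ℝ) else 1)]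
    have hu : (Finset.univ : Finset (ZMod 2)) = {0, 1} := by decide
    rw [hu, Finset.sum_pair (by decide)]
    norm_num [div_pow]
  rw [← hsum, Finset.sum_mul, Finset.card_eq_sum_ones, Nat.cast_sum]
  refine (Finset.sum_le_sum fun y hy => ?_).trans
    (Finset.sum_le_univ_sum_of_nonneg fun y => by positivity)
  have hy' := (Finset.mem_filter.1 hy).2
  calc ((1 : ℕ) : ℝ) = (1 / 16) ^ m * 16 ^ m := by rw [← mul_pow]; norm_num
    _ ≤ _ := mul_le_mul_of_nonneg_right
      (pow_le_pow_of_le_one (by norm_num) (by norm_num) hy') (by positivity)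

theorem card_hammingNorm_le (m : ℕ) :
    ((Finset.univ.filter fun y : Fin (16 * m) → ZMod 2 => hammingNorm y ≤ m).card : ℝ)
      ≤ 43 ^ m := by
  refine (card_hammingNorm_le_mul_pow m).trans ?_
  rw [pow_mul, ← mul_pow]
  -- `(17/16) ^ 16 * 16 < 43`; what matters later is that `43 < 2 ^ 8`.
  exact pow_le_pow_left₀ (by norm_num) (by norm_num) m

/-- A linear code of rate at least `1/2` and relative distance above `1/16`, given by its
parity-check matrix. -/
theorem exists_parityCheck (m : ℕ) :
    ∃ G : Matrix (Fin (8 * m)) (Fin (16 * m)) (ZMod 2),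
      ∀ y, G *ᵥ y = 0 → y ≠ 0 → m < hammingNorm y := by
  by_contra! hcon
  rcases Nat.eq_zero_or_pos m with rfl | hm
  · obtain ⟨y, -, hy, -⟩ := hcon 0
    exact hy (funext fun i => i.elim0)
  -- Union bound: each nonzero `y` is killed by at most a fraction `2 ^ (-8m)` of the matrices, and
  -- there are too few light `y` to spoil them all.
  set M := Matrix (Fin (8 * m)) (Fin (16 * m)) (ZMod 2)
  set B := Finset.univ.filter fun y : Fin (16 * m) → ZMod 2 => hammingNorm y ≤ m with hB
  have hcover : (Finset.univ : Finset M)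
      ⊆ (B.erase 0).biUnion fun y => Finset.univ.filter fun G : M => G *ᵥ y = 0 := by
    intro G _
    obtain ⟨y, hG, hy, hym⟩ := hcon G
    simp only [Finset.mem_biUnion, Finset.mem_erase, Finset.mem_filter, Finset.mem_univ,
      true_and, hB]
    exact ⟨y, ⟨hy, hym⟩, hG⟩
  have h1 : Fintype.card M * 2 ^ (8 * m) ≤ B.card * Fintype.card M := by
    calc Fintype.card M * 2 ^ (8 * m)
        ≤ (∑ y ∈ B.erase 0, (Finset.univ.filter fun G : M => G *ᵥ y = 0).card) * 2 ^ (8 * m) :=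
          Nat.mul_le_mul_right _ ((Finset.card_le_card hcover).trans Finset.card_biUnion_le)
      _ ≤ ∑ y ∈ B.erase 0, Fintype.card M := by
          rw [Finset.sum_mul]
          exact Finset.sum_le_sum fun y hy =>
            card_mulVec_eq_zero_mul_le (Finset.ne_of_mem_erase hy)
      _ ≤ B.card * Fintype.card M := by
          rw [Finset.sum_const, smul_eq_mul]
          exact Nat.mul_le_mul_right _ (Finset.card_erase_le)
  have h2 : 2 ^ (8 * m) ≤ B.card := by
    refine Nat.le_of_mul_le_mul_left (h1.trans_eq (mul_comm _ _)) Fintype.card_pos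
  have h3 := card_hammingNorm_le m
  have h4 : B.card ≤ 43 ^ m := by exact_mod_cast h3
  have h5 : (43 : ℕ) ^ m < 2 ^ (8 * m) := by
    rw [pow_mul]; exact Nat.pow_lt_pow_left (by norm_num) hm.ne'
  omega

/-! ### Cosets as points of the Earth Mover's space -/

theorem matchingCost_ofEquiv_le {α : Type u} [PseudoMetricSpace α] {s : ℕ} {ι : Type*} [Fintype ι]
    (e : Fin s ≃ ι) (a b : ι → α) : matchingCost (a ∘ e) (b ∘ e) ≤ ∑ i, dist (a i) (b i) := by
  refine (EMD.matchingCost_le _ _ 1).trans_eq ?_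
  exact Equiv.sum_comp e fun i => dist (a i) (b i)

theorem card_mul_le_matchingCost {α : Type u} [PseudoMetricSpace α] {s : ℕ} {ι κ : Type*}
    [Fintype ι] [Fintype κ] (e : Fin s ≃ ι ⊕ κ) (a b : ι ⊕ κ → α) {t : ℝ}
    (ht : ∀ i j, t ≤ dist (a (.inl i)) (b j)) :
    Fintype.card ι * t ≤ matchingCost (a ∘ e) (b ∘ e) := by
  refine le_ciInf fun π => ?_
  rw [← Equiv.sum_comp e.symm, Fintype.sum_sum_type]
  simp only [Function.comp_apply, Equiv.apply_symm_apply]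
  calc (Fintype.card ι : ℝ) * t = ∑ _ : ι, t := by simp
    _ ≤ _ := le_add_of_le_of_nonneg (Finset.sum_le_sum fun i _ => ht i _)
      (Finset.sum_nonneg fun i _ => dist_nonneg)

/-- The vector `x ∈ 𝔽₂ⁿ` as a point of the hypercube, padded by `n` zeros. -/
def padZero {n : ℕ} (x : Fin n → ZMod 2) : Hypercube (n + n) :=
  Hamming.toHamming (Fin.append (fun i => decide (x i ≠ 0)) fun _ => false)

theorem dist_padZero {n : ℕ} (x y : Fin n → ZMod 2) :
    dist (padZero x) (padZero y) = hammingNorm (x + y) := by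
  have hz : ∀ a b : ZMod 2, (decide (a ≠ 0) ≠ decide (b ≠ 0)) ↔ a + b ≠ 0 := by decide
  rw [Hamming.dist_eq_hammingDist]
  norm_cast
  rw [hammingDist, hammingNorm, Finset.card_filter, Finset.card_filter, Fin.sum_univ_add]
  simp only [padZero, Hamming.ofHamming_toHamming, Fin.append_left, Fin.append_right, hz]
  simp

theorem le_dist_padZero_true {n : ℕ} (x : Fin n → ZMod 2) :
    (n : ℝ) ≤ dist (padZero x) (Hamming.toHamming fun _ => true) := by
  rw [Hamming.dist_eq_hammingDist]
  norm_cast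
  rw [hammingDist, Finset.card_filter, Fin.sum_univ_add]
  simp only [padZero, Hamming.ofHamming_toHamming, Fin.append_left, Fin.append_right]
  simp

/-- The coset of `x` by the row space of `G`, padded by copies of a far point to a multiset of
`s` points. -/
noncomputable def cosetEMD {n k s : ℕ} (e : Fin s ≃ (Fin k → ZMod 2) ⊕ Fin (s - 2 ^ k))
    (G : Matrix (Fin k) (Fin n) (ZMod 2)) (x : Fin n → ZMod 2) : EMD (Hypercube (n + n)) s :=
  EMD.ofTuple (Sum.elim (fun u => padZero (x + u ᵥ* G))
    (fun _ => Hamming.toHamming fun _ => true) ∘ e)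

section cosetEMD

variable {n k s : ℕ} (e : Fin s ≃ (Fin k → ZMod 2) ⊕ Fin (s - 2 ^ k))
  (G : Matrix (Fin k) (Fin n) (ZMod 2))

/-- Translation by a row-space vector only permutes the coset; this is what makes every hash of it
invariant. -/
theorem cosetEMD_add_vecMul (x : Fin n → ZMod 2) (u : Fin k → ZMod 2) :
    cosetEMD e G (x + u ᵥ* G) = cosetEMD e G x := by
  refine (EMD.ofTuple_eq_iff _ _).2
    ⟨(e.trans (Equiv.sumCongr (Equiv.addLeft u) (Equiv.refl _))).trans e.symm, funext fun i => ?_⟩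
  simp only [Function.comp_apply, Equiv.trans_apply, Equiv.apply_symm_apply]
  rcases e i with w | j
  · simp [add_vecMul, add_assoc]
  · simp

theorem dist_cosetEMD_le (x y : Fin n → ZMod 2) :
    dist (cosetEMD e G x) (cosetEMD e G y) ≤ 2 ^ k * hammingNorm (x + y) := by
  rw [cosetEMD, cosetEMD, EMD.dist_ofTuple]
  refine (matchingCost_ofEquiv_le _ _ _).trans_eq ?_
  have h : ∀ w : Fin n → ZMod 2, x + w + (y + w) = x + y := fun w => by
    rw [add_add_add_comm, add_self_zmod_two, add_zero]
  rw [Fintype.sum_sum_type]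
  simp only [Sum.elim_inl, Sum.elim_inr, dist_padZero, h]
  simp [ZMod.card]

/-- Otherwise each of the `2 ^ k` coset points would pay at least `m + 1` in any matching. The far
point is no cheaper a partner, as it lies at distance at least `n > m`. -/
theorem exists_hammingNorm_le_of_dist_cosetEMD_lt {m : ℕ} (hmn : m < n) {x y : Fin n → ZMod 2}
    (h : dist (cosetEMD e G x) (cosetEMD e G y) < 2 ^ k * (m + 1)) :
    ∃ u : Fin k → ZMod 2, hammingNorm (x + y + u ᵥ* G) ≤ m := by
  by_contra! hcon
  refine h.not_ge ?_
  rw [cosetEMD, cosetEMD, EMD.dist_ofTuple]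
  have hc : ((2 : ℝ) ^ k) = Fintype.card (Fin k → ZMod 2) := by simp [ZMod.card]
  rw [hc]
  refine card_mul_le_matchingCost e _ _ fun i j => ?_
  rcases j with w | j
  · have h1 : x + i ᵥ* G + (y + w ᵥ* G) = x + y + (i + w) ᵥ* G := by
      rw [add_vecMul, add_add_add_comm]
    simp only [Sum.elim_inl, dist_padZero, h1]
    exact_mod_cast hcon (i + w)
  · simp only [Sum.elim_inl, Sum.elim_inr]
    refine le_trans ?_ (le_dist_padZero_true _)
    exact_mod_cast hmn

/-- Such `y` lie in a union of `2 ^ k` Hamming balls, centred at the points of the coset of `x`. -/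
theorem card_dist_cosetEMD_lt_le {m : ℕ} (hmn : m < n) (x : Fin n → ZMod 2) :
    (Finset.univ.filter fun y =>
      dist (cosetEMD e G x) (cosetEMD e G y) < 2 ^ k * ((m : ℝ) + 1)).card
      ≤ 2 ^ k * (Finset.univ.filter fun y : Fin n → ZMod 2 => hammingNorm y ≤ m).card := by
  classical
  have hk : (Finset.univ : Finset (Fin k → ZMod 2)).card = 2 ^ k := by simp [ZMod.card]
  rw [← hk, ← Finset.card_product]
  refine (Finset.card_le_card fun y hy => ?_).trans
    (Finset.card_image_le (f := fun p : (Fin k → ZMod 2) × (Fin n → ZMod 2) =>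
      x + p.1 ᵥ* G + p.2))
  obtain ⟨u, hu⟩ := exists_hammingNorm_le_of_dist_cosetEMD_lt e G hmn (Finset.mem_filter.1 hy).2
  refine Finset.mem_image.2 ⟨(u, x + y + u ᵥ* G), by simpa using hu, ?_⟩
  have : x + u ᵥ* G + (x + y + u ᵥ* G) = (x + x) + (u ᵥ* G + u ᵥ* G) + y := by abel
  simp only [this, add_self_zmod_two, zero_add]

end cosetEMD

/-! ### Averaging over the random hash -/

open Classical in
theorem integrable_ite_one_zero {H : Type*} [MeasurableSpace H] (D : Measure H)
    [IsFiniteMeasure D] {P : H → Prop} (hP : MeasurableSet {h | P h}) :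
    Integrable (fun h => if P h then (1 : ℝ) else 0) D :=
  (integrable_const (1 : ℝ)).indicator hP

open Classical in
theorem integral_ite_one_zero {H : Type*} [MeasurableSpace H] (D : Measure H)
    {P : H → Prop} (hP : MeasurableSet {h | P h}) :
    ∫ h, (if P h then (1 : ℝ) else 0) ∂D = D.real {h | P h} :=
  integral_indicator_one hP

/-- The uniform distribution on the values of a finite family. -/
noncomputable def uniformFamily {Ω V : Type*} [MeasurableSpace Ω] [Fintype V] (X : V → Ω) :
    Measure Ω :=
  (Fintype.card V : ENNReal)⁻¹ • ∑ y, Measure.dirac (X y)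

instance isProbabilityMeasure_uniformFamily {Ω V : Type*} [MeasurableSpace Ω] [Fintype V]
    [Nonempty V] (X : V → Ω) : IsProbabilityMeasure (uniformFamily X) := by
  refine ⟨?_⟩
  rw [uniformFamily, Measure.smul_apply, Measure.finsetSum_apply]
  simp [ENNReal.inv_mul_cancel]

theorem prod_uniformFamily_real {H Ω V : Type*} [MeasurableSpace H] [MeasurableSpace Ω]
    [Fintype V] [Nonempty V] (D : Measure H) [IsProbabilityMeasure D] (X : V → Ω)
    {E : Set (H × Ω)} (hE : MeasurableSet E) :
    (D.prod (uniformFamily X)).real E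
      = (Fintype.card V : ℝ)⁻¹ * ∑ y, D.real {h | (h, X y) ∈ E} := by
  have hm := measurable_measure_prodMk_right (μ := D) hE
  rw [Measure.real, Measure.prod_apply_symm hE, uniformFamily, lintegral_smul_measure,
    lintegral_finsetSum_measure]
  simp_rw [lintegral_dirac' _ hm]
  rw [smul_eq_mul, ENNReal.toReal_mul, ENNReal.toReal_sum fun _ _ => measure_ne_top _ _]
  simp [Measure.real, Set.preimage]

theorem sum_walk_collision_real_le {n k K : ℕ} (G : Matrix (Fin k) (Fin n) (ZMod 2))
    {X : Type u} {U : Type v} [MeasurableSpace (X → U)] (D : Measure (X → U))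
    [IsProbabilityMeasure D] (hD : ∀ x y : X, MeasurableSet {h : X → U | h x = h y})
    (g : (Fin n → ZMod 2) → X) (hg : ∀ x u, g (x + u ᵥ* G) = g x) {ρ : ℝ} (hρ0 : 0 ≤ ρ)
    (hρ : ∀ S, G *ᵥ S = 0 → S ≠ 0 → (n : ℝ) - hammingNorm S ≤ ρ * n) :
    2 ^ n * ∑ w : Fin K → Fin n × ZMod 2, ∑ x, D.real {h | h (g x) = h (g (x + walkSum w))}
      ≤ (2 * n) ^ K * (∑ x, ∑ y, D.real {h | h (g x) = h (g y)} + ρ ^ K * 4 ^ n) := by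
  classical
  have hi := fun x y => integrable_ite_one_zero D (hD (g x) (g y))
  have h1 := integral_mono (μ := D)
    ((integrable_finsetSum Finset.univ fun (w : Fin K → Fin n × ZMod 2) _ =>
      integrable_finsetSum Finset.univ fun x _ => hi x (x + walkSum w)).const_mul (2 ^ n))
    (((integrable_finsetSum Finset.univ fun x _ =>
      integrable_finsetSum Finset.univ fun y _ => hi x y).add
        (integrable_const (ρ ^ K * 4 ^ n))).const_mul ((2 * (n : ℝ)) ^ K))
    (fun h => sum_walk_collision_le G (fun x => h (g x)) (fun x u => by rw [hg]) hρ0 hρ)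
  simp only [Pi.add_apply] at h1
  rw [integral_const_mul, integral_const_mul, integral_add
    (integrable_finsetSum Finset.univ fun x _ => integrable_finsetSum Finset.univ fun y _ => hi x y)
    (integrable_const _), integral_finsetSum _ fun w _ =>
      integrable_finsetSum Finset.univ fun x _ => hi x (x + walkSum w),
    integral_finsetSum _ fun x _ => integrable_finsetSum Finset.univ fun y _ => hi x y] at h1
  simp_rw [integral_finsetSum Finset.univ fun x _ => hi x (x + walkSum _),
    integral_finsetSum Finset.univ fun y _ => hi _ y, integral_ite_one_zero D (hD _ _)] at h1
  simpa using h1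

/-- Far values are controlled by sensitivity for the uniform distribution on the family; each of the
at most `N` near ones costs at most `1`. -/
theorem sum_collision_le_of_far {X : Type u} {U : Type v} [MetricSpace X] [MeasurableSpace X]
    [MeasurableSpace (X → U)] {D : Measure (X → U)} [IsProbabilityMeasure D]
    {V : Type*} [Fintype V] [Nonempty V] {g : V → X} {r R p₁ p₂ : ℝ}
    (hD : IsSensitiveFor D (uniformFamily g) r R p₁ p₂) (x : X) {N : ℕ}
    (hN : (Finset.univ.filter fun y => dist x (g y) ≤ R).card ≤ N) :
    ∑ y, D.real {h | h x = h (g y)} ≤ Fintype.card V * p₂ + N := by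
  have h1 := hD.far_separate x
  rw [prod_uniformFamily_real D g (hD.measurableSet_far_collide x),
    inv_mul_le_iff₀ (by exact_mod_cast Fintype.card_pos)] at h1
  have h2 : ((Finset.univ.filter fun y => dist x (g y) ≤ R).card : ℝ) ≤ N := by exact_mod_cast hN
  rw [Finset.card_filter] at h2
  push_cast at h2
  refine le_trans ?_ (add_le_add h1 h2)
  rw [← Finset.sum_add_distrib]
  refine Finset.sum_le_sum fun y _ => ?_
  by_cases hy : dist x (g y) ≤ R
  · rw [if_pos hy]
    exact measureReal_le_one.trans (le_add_of_nonneg_left measureReal_nonneg)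
  · rw [if_neg hy, add_zero]
    simp [not_le.1 hy]

/-! ### The gap inequality and the choice of constants -/

theorem sensitive_gap_le {m s K : ℕ} (hm : 1 ≤ m) (hs : 2 ^ (8 * m) ≤ s) {c p₁ p₂ : ℝ}
    (hcK : c * K < m + 1)
    (h : HasDataDependentLSH.{0, v} (EMD (Hypercube (16 * m + 16 * m)) s) (2 ^ (8 * m) * K)
      (c * (2 ^ (8 * m) * K)) p₁ p₂) :
    p₁ ≤ p₂ + (43 / 256) ^ m + (15 / 16) ^ K := by
  obtain ⟨G, hG⟩ := exists_parityCheck m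
  have hcard : Fintype.card (Fin s)
      = Fintype.card ((Fin (8 * m) → ZMod 2) ⊕ Fin (s - 2 ^ (8 * m))) := by
    simp [ZMod.card]; omega
  have e := Fintype.equivOfCardEq hcard
  set g := cosetEMD e G with hg
  obtain ⟨U, _, D, _, hD⟩ := h (uniformFamily g) inferInstance
  have hm' : (1 : ℝ) ≤ m := by exact_mod_cast hm
  have hclose : ∀ x (w : Fin K → Fin (16 * m) × ZMod 2),
      p₁ ≤ D.real {h | h (g x) = h (g (x + walkSum w))} := fun x w => by
    refine hD.close_collide _ _ ((dist_cosetEMD_le e G _ _).trans ?_)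
    rw [← add_assoc, add_self_zmod_two, zero_add]
    exact mul_le_mul_of_nonneg_left (by exact_mod_cast hammingNorm_walkSum_le w) (by positivity)
  have hfar : ∀ x, ∑ y, D.real {h | h (g x) = h (g y)} ≤ 2 ^ (16 * m) * p₂ + 2 ^ (8 * m) * 43 ^ m := by
    intro x
    have hc := card_hammingNorm_le m
    have h1 := sum_collision_le_of_far hD (g x)
      (N := 2 ^ (8 * m) * (Finset.univ.filter fun y : Fin (16 * m) → ZMod 2 =>
        hammingNorm y ≤ m).card) ?_
    · refine h1.trans ?_
      push_cast
      have : (Fintype.card (Fin (16 * m) → ZMod 2) : ℝ) = 2 ^ (16 * m) := by simp [ZMod.card]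
      rw [this]
      gcongr
    · refine le_trans (Finset.card_le_card fun y hy => ?_)
        (card_dist_cosetEMD_lt_le e G (by omega : m < 16 * m) x)
      refine Finset.mem_filter.2 ⟨Finset.mem_univ _, (Finset.mem_filter.1 hy).2.trans_lt ?_⟩
      have : (0 : ℝ) < 2 ^ (8 * m) := by positivity
      nlinarith
  have key := sum_walk_collision_real_le (K := K) G D hD.measurableSet_collide g
    (cosetEMD_add_vecMul e G) (ρ := 15 / 16) (by norm_num) fun S hS hS0 => by
      have : (m : ℝ) < hammingNorm S := by exact_mod_cast hG S hS hS0
      push_cast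
      linarith
  have hlow : (2 * ((16 * m : ℕ) : ℝ)) ^ K * (4 ^ (16 * m) * p₁)
      ≤ 2 ^ (16 * m) * ∑ w : Fin K → Fin (16 * m) × ZMod 2, ∑ x,
        D.real {h | h (g x) = h (g (x + walkSum w))} := by
    have h1 : ∑ w : Fin K → Fin (16 * m) × ZMod 2, ∑ x : Fin (16 * m) → ZMod 2, p₁
        ≤ ∑ w : Fin K → Fin (16 * m) × ZMod 2, ∑ x,
          D.real {h | h (g x) = h (g (x + walkSum w))} :=
      Finset.sum_le_sum fun w _ => Finset.sum_le_sum fun x _ => hclose x w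
    refine le_trans (le_of_eq ?_)
      (mul_le_mul_of_nonneg_left h1 (by positivity : (0 : ℝ) ≤ 2 ^ (16 * m)))
    have h4 : (4 : ℝ) ^ (16 * m) = 2 ^ (16 * m) * 2 ^ (16 * m) := by rw [← mul_pow]; norm_num
    simp only [Finset.sum_const, Finset.card_univ, nsmul_eq_mul, Fintype.card_pi_const,
      Fintype.card_prod, Fintype.card_fin, ZMod.card, h4]
    push_cast
    ring
  have hup : ∑ x, ∑ y, D.real {h | h (g x) = h (g y)}
      ≤ 4 ^ (16 * m) * (p₂ + (43 / 256) ^ m) := by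
    refine (Finset.sum_le_sum fun x _ => hfar x).trans_eq ?_
    simp only [Finset.sum_const, Finset.card_univ, nsmul_eq_mul, Fintype.card_pi_const, ZMod.card]
    push_cast
    have h4 : (4 : ℝ) ^ (16 * m) = 2 ^ (16 * m) * 2 ^ (16 * m) := by rw [← mul_pow]; norm_num
    have h5 : (2 : ℝ) ^ (16 * m) * (43 / 256) ^ m = 2 ^ (8 * m) * 43 ^ m := by
      rw [pow_mul, pow_mul, ← mul_pow, ← mul_pow]; norm_num
    rw [h4, mul_assoc, mul_add (2 ^ (16 * m)) p₂, h5]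
  have hpos : (0 : ℝ) < (2 * ((16 * m : ℕ) : ℝ)) ^ K := by
    push_cast; positivity
  have h1 := le_of_mul_le_mul_left (hlow.trans key) hpos
  have h2 : (0 : ℝ) < 4 ^ (16 * m) := by positivity
  refine le_of_mul_le_mul_left (h1.trans ((add_le_add_left hup _).trans_eq ?_)) h2
  ring

theorem mainTheorem5 (p₁ p₂ : ℝ) (hp₂ : 0 < p₂) (hp : p₂ < p₁) (hp₁ : p₁ < 1) :
    ∃ C : ℝ, 0 < C ∧ ∀ s : ℕ, 1 ≤ s → ∀ c : ℝ, 1 < c →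
      (∀ d : ℕ, 1 ≤ d → ∀ r : ℝ, 0 < r →
        HasDataDependentLSH.{0, v} (EMD (Hypercube d) s) r (c * r) p₁ p₂) →
      C * Real.log s ≤ c := by
  have hgap : 0 < (p₁ - p₂) / 2 := by linarith
  -- Each error term takes half of the gap `p₁ - p₂`. Adding `1` below makes the walk length, hence
  -- the radius `r`, positive.
  obtain ⟨K₀, hK₀⟩ := exists_pow_lt_of_lt_one hgap (by norm_num : (15 / 16 : ℝ) < 1)
  obtain ⟨m₀, hm₀⟩ := exists_pow_lt_of_lt_one hgap (by norm_num : (43 / 256 : ℝ) < 1)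
  set K : ℝ := (K₀ : ℝ) + 1
  set M : ℝ := (m₀ : ℝ) + 1
  have hK : 1 ≤ K := le_add_of_nonneg_left K₀.cast_nonneg
  have hM : 1 ≤ M := le_add_of_nonneg_left m₀.cast_nonneg
  refine ⟨1 / (8 * (K * M)), by positivity, fun s hs c hc h => ?_⟩
  rw [div_mul_eq_mul_div, one_mul, div_le_iff₀ (by positivity)]
  obtain ⟨m, hm⟩ : ∃ m, m = Nat.log 2 s / 8 := ⟨_, rfl⟩
  have hlog : Real.log s ≤ 8 * ((m : ℝ) + 1) := by
    have h1 : s < 2 ^ (8 * (m + 1)) :=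
      (Nat.lt_pow_succ_log_self (by norm_num) s).trans_le
        (Nat.pow_le_pow_right (by norm_num) (by omega))
    have h2 : Real.log s ≤ Real.log (2 ^ (8 * (m + 1))) :=
      Real.log_le_log (by exact_mod_cast hs) (by exact_mod_cast h1.le)
    rw [Real.log_pow] at h2
    have h3 := Real.log_two_lt_d9
    push_cast at h2
    have h4 : (0 : ℝ) ≤ 8 * (m + 1) := by positivity
    nlinarith
  have hKM : 1 ≤ K * M := one_le_mul_of_one_le_of_one_le hK hM
  -- For small `s` the hypothesis `1 < c` suffices; the factor `M` in the constant absorbs this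
  -- range.
  rcases Nat.lt_or_ge m (m₀ + 1) with hlt | hge
  · have h1 : (m : ℝ) + 1 ≤ M := by
      have h0 : (m : ℝ) ≤ m₀ := by exact_mod_cast Nat.lt_succ_iff.1 hlt
      exact add_le_add_left h0 1
    have h2 : M ≤ K * M := le_mul_of_one_le_left (by linarith) hK
    have h3 : K * M ≤ c * (K * M) := le_mul_of_one_le_left (by linarith) hc.le
    linarith
  · have hs' : 2 ^ (8 * m) ≤ s :=
      (Nat.pow_le_pow_right (by norm_num) (by omega)).trans (Nat.pow_log_le_self 2 (by omega))
    have hcK : (m : ℝ) + 1 ≤ c * K := by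
      by_contra! hcon
      have h1 := sensitive_gap_le (K := K₀ + 1) (by omega : 1 ≤ m) hs'
        (by push_cast; exact hcon) (h (16 * m + 16 * m) (by omega) _ (by positivity))
      have h2 : (43 / 256 : ℝ) ^ m ≤ (43 / 256) ^ m₀ :=
        pow_le_pow_of_le_one (by norm_num) (by norm_num) (by omega)
      have h3 : (15 / 16 : ℝ) ^ (K₀ + 1) ≤ (15 / 16) ^ K₀ :=
        pow_le_pow_of_le_one (by norm_num) (by norm_num) (by omega)
      linarith
    have h1 : c * K ≤ c * K * M := le_mul_of_one_le_right (by positivity) hM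
    linarith
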